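/- Let $M$ be a countable model of first-order Peano arithmetic PA in the language $\{0,1,+,\cdot,<\}$. Write $\mathrm{Def}(M)$ for the collection of subsets of $M$ that are first-order definable in $M$ with parameters from $M$. Suppose that: (1) $M$ has no proper cofinal elementary submodel, i.e. every elementary submodel $K \preceq M$ such that for each $a \in M$ there is $b \in K$ with $a \le b$ is equal to $M$; (2) $M$ is a conservative extension of each of its elementary cuts, i.e. for every proper elementary submodel $K \prec M$ that is an initial segment of $M$, and every $X \in \mathrm{Def}(M)$, we have $X \cap K \in \mathrm{Def}(K)$. Call $X \subseteq M$ a class of $M$ if $\{x \in X : x < a\} \in \mathrm{Def}(M)$ for every $a \in M$, and undefinable if $X \notin \mathrm{Def}(M)$. Then for every undefinable class $X$ of $M$, the expansion $(M,X)$ of $M$ by a unary predicate for $X$ is pointwise definable: every element of $M$ is definable without parameters in $(M,X)$. In particular, if moreover $M$ is not a prime model (i.e. $M$ does not embed elementarily into every model of its complete theory), then $M$ is an Enayat model, that is, a countable non-prime model of PA such that $(M,X)$ is pointwise definable for every undefinable class $X$ of $M$. -/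

import Mathlib

open FirstOrder FirstOrder.Language

namespace PAModels

universe u

/-- Function symbols of the language of arithmetic: `0`, `1`, `+`, `·`. -/
inductive ArithFunc : ℕ → Type
  | zero : ArithFunc 0
  | one : ArithFunc 0
  | add : ArithFunc 2
  | mul : ArithFunc 2

/-- Relation symbols of the language of arithmetic: `<`. -/
inductive ArithRel : ℕ → Type
  | lt : ArithRel 2

/-- The first-order language of arithmetic `{0, 1, +, ·, <}`. -/
def arith : FirstOrder.Language.{0, 0} := ⟨ArithFunc, ArithRel⟩

section ArithTerms

variable {α : Type u}

/-- The term `0`. -/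
def tZero : arith.Term α := Constants.term (L := arith) ArithFunc.zero

/-- The term `1`. -/
def tOne : arith.Term α := Constants.term (L := arith) ArithFunc.one

/-- The term `s + t`. -/
def tAdd (s t : arith.Term α) : arith.Term α :=
  Functions.apply₂ (L := arith) ArithFunc.add s t

/-- The term `s · t`. -/
def tMul (s t : arith.Term α) : arith.Term α :=
  Functions.apply₂ (L := arith) ArithFunc.mul s t

/-- The atomic formula `s < t`. -/
def fLt {n : ℕ} (s t : arith.Term (α ⊕ Fin n)) : arith.BoundedFormula α n :=
  Relations.boundedFormula₂ (L := arith) ArithRel.lt s t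

end ArithTerms

/-- The basic axioms: successor `x + 1` is injective and omits `0`, the recursion equations for
`+` and `·`, and the definition of `<` by `x < y ↔ ∃ z, x + (z + 1) = y`. -/
def basicAxioms : arith.Theory :=
  { ∀' ∼(tAdd (&0) tOne =' tZero),
    ∀' ∀' ((tAdd (&0) tOne =' tAdd (&1) tOne) ⟹ (&0 =' &1)),
    ∀' (tAdd (&0) tZero =' &0),
    ∀' ∀' (tAdd (&0) (tAdd (&1) tOne) =' tAdd (tAdd (&0) (&1)) tOne),
    ∀' (tMul (&0) tZero =' tZero),
    ∀' ∀' (tMul (&0) (tAdd (&1) tOne) =' tAdd (tMul (&0) (&1)) (&0)),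
    ∀' ∀' ((fLt (&0) (&1)) ⇔ ∃' (tAdd (&0) (tAdd (&2) tOne) =' &1)) }

/-- The induction axiom for a formula `φ(p, x)`, where `p = (p₀, …, pₙ₋₁)` are the parameters
(the variables `Sum.inl i`) and `x` is the induction variable (`Sum.inr 0`):
`∀ p, φ(p, 0) ∧ (∀ x, φ(p, x) → φ(p, x + 1)) → ∀ x, φ(p, x)`. -/
noncomputable def inductionAxiom {n : ℕ} (φ : arith.Formula (Fin n ⊕ Fin 1)) : arith.Sentence :=
  let base : arith.Formula (Fin n) :=
    BoundedFormula.subst φ (Sum.elim Term.var fun _ => tZero)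
  let shifted : arith.Formula (Fin n ⊕ Fin 1) :=
    BoundedFormula.subst φ
      (Sum.elim (fun i => Term.var (Sum.inl i)) fun j => tAdd (Term.var (Sum.inr j)) tOne)
  let step : arith.Formula (Fin n) := Formula.iAlls (Fin 1) (φ.imp shifted)
  let all : arith.Formula (Fin n) := Formula.iAlls (Fin 1) φ
  Formula.iAlls (α := Empty) (Fin n) (Formula.relabel Sum.inr ((base ⊓ step).imp all))

/-- First-order Peano arithmetic. -/
def PA : arith.Theory :=
  basicAxioms ∪ {σ | ∃ (n : ℕ) (φ : arith.Formula (Fin n ⊕ Fin 1)), σ = inductionAxiom φ}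

/-- The order of an arithmetic structure: the interpretation of the symbol `<`. -/
def Lt {M : Type u} [arith.Structure M] (a b : M) : Prop :=
  Structure.RelMap (L := arith) ArithRel.lt ![a, b]

/-- `X ∈ Def(M)`: the subset `X` is definable in `M` with parameters from `M`. -/
def IsDef (M : Type u) [arith.Structure M] (X : Set M) : Prop := (Set.univ : Set M).Definable₁ arith X

/-- A subset `X` is a class if `{x ∈ X : x < a}` is definable with parameters, for every `a`. -/
def IsClass (M : Type u) [arith.Structure M] (X : Set M) : Prop := ∀ a : M, IsDef M {x | x ∈ X ∧ Lt x a}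

/-- `K` is cofinal in `M`: no element of `M` lies strictly above all of `K`. -/
def IsCofinal {M : Type u} [arith.Structure M]
    (K : arith.ElementarySubstructure M) : Prop :=
  ∀ a : M, ∃ b ∈ K, a = b ∨ Lt a b

/-- `K ≺ M` is an elementary cut: a proper elementary submodel that is an initial segment. -/
def IsElementaryCut {M : Type u} [arith.Structure M]
    (K : arith.ElementarySubstructure M) : Prop :=
  K ≠ ⊤ ∧ ∀ a ∈ K, ∀ b : M, Lt b a → b ∈ K

/-- `M` is a conservative extension of its elementary submodel `K`: for each `X ∈ Def(M)`, the
trace `X ∩ K` belongs to `Def(K)`. -/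
def IsConservative {M : Type u} [arith.Structure M]
    (K : arith.ElementarySubstructure M) : Prop :=
  ∀ X : Set M, IsDef M X → IsDef K {x : K | (x : M) ∈ X}

/-- Relation symbols of the language with a single unary predicate. -/
inductive PredRel : ℕ → Type
  | pred : PredRel 1

/-- The language consisting of one unary predicate symbol. -/
def predLang : FirstOrder.Language.{0, 0} := ⟨fun _ => Empty, PredRel⟩

/-- The interpretation of the unary predicate symbol by `X`. -/
@[reducible] def predStructure {M : Type u} (X : Set M) : predLang.Structure M where
  funMap f := Empty.elim f
  RelMap
    | .pred, v => v 0 ∈ X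

/-- `(M, X)` is pointwise definable: every element of `M` is definable without parameters in the
expansion of `M` by a predicate for `X`. -/
def PointwiseDefinable (M : Type u) [arith.Structure M] (X : Set M) : Prop :=
  letI := predStructure X
  ∀ a : M, (∅ : Set M).Definable₁ (arith.sum predLang) {a}

/-- `M` is a prime model (of its complete theory): it embeds elementarily into every model of
that theory. -/
def IsPrimeModel (M : Type u) [arith.Structure M] : Prop :=
  ∀ (N : Type u) [arith.Structure N], N ⊨ arith.completeTheory M → Nonempty (M ↪ₑ[arith] N)

/-- Enayat models: countable non-prime models `M` of `PA` such that `(M, X)` is pointwise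
definable for every undefinable class `X` of `M`. -/
def IsEnayat (M : Type u) [arith.Structure M] : Prop :=
  M ⊨ PA ∧ Countable M ∧ ¬ IsPrimeModel M ∧
    ∀ X : Set M, IsClass M X → ¬ IsDef M X → PointwiseDefinable M X

end PAModels

namespace PAModels

/-! ### Closure properties of definable relations -/

section Definability

variable {L : FirstOrder.Language} {M : Type*} [L.Structure M] {A : Set M} {α β : Type*}

/-! Let `K` be the set of elements definable in `(M, X)`. Least witnesses make `K` an elementary
submodel of `M`. If `K ≠ M`, then `K` is not cofinal, and collection makes its downward closure `C`
an elementary submodel too, hence a proper elementary cut. The class `X`, cut off at a point above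
`C`, is definable in `M`, so conservativity yields a formula `θ` and parameters `c` in `C` with
`θ(c, ·)` equal to `X` on `C`.

The tuple `c` need not lie in `K`, but the set it defines in `M` is definable in `(M, X)`. Take `b`
in `K` above `c`, and by collection `e` in `K` such that tuples below `b` defining different sets
already differ below `e`. Then every `d` below `b` for which `θ(d, ·)` agrees with `X` below `e`
defines the same set as `c`. As `X` is undefinable, that set differs from `X`. The least point of
difference is definable in `(M, X)`, so it lies in `K ⊆ C`, where the two sets agree: a
contradiction. The key lemmas are `meetsDefinable_boundedElements` and
`exists_bound_mem_definableElements`. -/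

theorem definable_and {P Q : (α → M) → Prop} (hP : A.Definable L {v | P v})
    (hQ : A.Definable L {v | Q v}) : A.Definable L {v | P v ∧ Q v} :=
  hP.inter hQ

theorem definable_not {P : (α → M) → Prop} (hP : A.Definable L {v | P v}) :
    A.Definable L {v | ¬ P v} :=
  hP.compl

theorem definable_imp {P Q : (α → M) → Prop} (hP : A.Definable L {v | P v})
    (hQ : A.Definable L {v | Q v}) : A.Definable L {v | P v → Q v} := by
  convert! hP.himp hQ using 1

theorem definable_iff {P Q : (α → M) → Prop} (hP : A.Definable L {v | P v})
    (hQ : A.Definable L {v | Q v}) : A.Definable L {v | P v ↔ Q v} := by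
  simp only [iff_iff_implies_and_implies]
  exact definable_and (definable_imp hP hQ) (definable_imp hQ hP)

theorem definable_forall_finite {ι : Type*} [Finite ι] {P : ι → (α → M) → Prop}
    (hP : ∀ i, A.Definable L {v | P i v}) : A.Definable L {v | ∀ i, P i v} := by
  convert! Set.definable_iInter_of_finite hP using 1
  ext v
  simp

theorem definable_exists_tuple [Finite β] {P : (α → M) → (β → M) → Prop}
    (hP : A.Definable L {w : α ⊕ β → M | P (fun i => w (Sum.inl i)) fun i => w (Sum.inr i)}) :
    A.Definable L {v | ∃ u, P v u} :=
  hP.exists_of_finite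

theorem definable_forall_tuple [Finite β] {P : (α → M) → (β → M) → Prop}
    (hP : A.Definable L {w : α ⊕ β → M | P (fun i => w (Sum.inl i)) fun i => w (Sum.inr i)}) :
    A.Definable L {v | ∀ u, P v u} :=
  hP.forall_of_finite

theorem definable_exists {P : (α → M) → M → Prop}
    (hP : A.Definable L {w : α ⊕ Fin 1 → M | P (fun i => w (Sum.inl i)) (w (Sum.inr 0))}) :
    A.Definable L {v | ∃ x, P v x} := by
  convert! definable_exists_tuple (P := fun v u => P v (u 0)) hP using 1
  ext v
  exact ⟨fun ⟨x, hx⟩ => ⟨fun _ => x, hx⟩, fun ⟨u, hu⟩ => ⟨u 0, hu⟩⟩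

theorem definable_forall {P : (α → M) → M → Prop}
    (hP : A.Definable L {w : α ⊕ Fin 1 → M | P (fun i => w (Sum.inl i)) (w (Sum.inr 0))}) :
    A.Definable L {v | ∀ x, P v x} := by
  convert! definable_forall_tuple (P := fun v u => P v (u 0)) hP using 1
  ext v
  exact ⟨fun h u => h (u 0), fun h x => h fun _ => x⟩

theorem definable_eq_const (i : α) {a : M} (ha : a ∈ A) : A.Definable L {v : α → M | v i = a} :=
  (Set.Definable.singleton_of_mem (L := L) ha).preimage_comp fun _ => i

theorem definable_mem {S : Set M} (hS : A.Definable₁ L S) (i : α) :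
    A.Definable L {v : α → M | v i ∈ S} :=
  hS.preimage_comp fun _ => i

theorem definable_prop (p : Prop) :
    A.Definable L {_v : α → M | p} := by
  by_cases hp : p <;> simp [hp]

theorem definable_comp {P : (α → M) → M → Prop}
    (hP : A.Definable L {w : α ⊕ Fin 1 → M | P (fun i => w (Sum.inl i)) (w (Sum.inr 0))})
    (f : α → β) (j : β) : A.Definable L {v : β → M | P (fun i => v (f i)) (v j)} :=
  hP.preimage_comp (Sum.elim f fun _ => j)

/-- Substituting parameters for some of the variables of a definable relation. -/
theorem definable_subst_params [Finite β] {R : Set (α ⊕ β → M)} (hR : A.Definable L R)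
    {c : β → M} (hc : ∀ i, c i ∈ A) : A.Definable L {v | Sum.elim v c ∈ R} := by
  have : A.Definable L {v | ∃ u : β → M, (∀ i, u i = c i) ∧ Sum.elim v u ∈ R} := by
    refine definable_exists_tuple (P := fun v u => (∀ i, u i = c i) ∧ Sum.elim v u ∈ R) ?_
    refine definable_and (definable_forall_finite fun i => definable_eq_const _ (hc i)) ?_
    convert! hR using 1
    ext w
    simp only [Set.mem_ofPred_eq]
    rw [show Sum.elim (fun i => w (Sum.inl i)) (fun i => w (Sum.inr i)) = w from
      Sum.elim_comp_inl_inr w]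
  convert! this using 1
  ext v
  constructor
  · exact fun h => ⟨c, fun _ => rfl, h⟩
  · rintro ⟨u, hu, h⟩
    rwa [funext hu] at h

theorem definable_subst_one {P : (α → M) → M → Prop}
    (hP : A.Definable L {w : α ⊕ Fin 1 → M | P (fun i => w (Sum.inl i)) (w (Sum.inr 0))})
    {a : M} (ha : a ∈ A) : A.Definable L {v | P v a} :=
  definable_subst_params hP (c := fun _ => a) fun _ => ha

/-- A definable relation is given by a formula and finitely many parameters. -/
theorem exists_formula_of_definable {R : Set (α → M)} (hR : A.Definable L R) :
    ∃ (n : ℕ) (c : Fin n → M) (φ : L.Formula (Fin n ⊕ α)),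
      (∀ i, c i ∈ A) ∧ ∀ v, v ∈ R ↔ φ.Realize (Sum.elim c v) := by
  obtain ⟨A₀, hA₀, hR⟩ := Set.definable_iff_finitely_definable.1 hR
  obtain ⟨φ, rfl⟩ := Set.definable_iff_exists_formula_sum.1 hR
  let e := Finite.equivFin (A₀ : Set M)
  refine ⟨_, fun i => (e.symm i : M), φ.relabel (Sum.map e id),
    fun i => hA₀ (e.symm i).2, fun v => ?_⟩
  simp only [Set.mem_ofPred_eq, Formula.realize_relabel]
  rw [iff_iff_eq]
  congr 1
  ext i
  rcases i with i | i <;> simp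

theorem definable_realize (φ : L.Formula α) : A.Definable L {v | φ.Realize v} :=
  Set.Definable.mono (Set.empty_definable_iff.2 ⟨φ, rfl⟩) (Set.empty_subset A)

/-- The elements definable without parameters. -/
def definableElements (L : FirstOrder.Language) (M : Type*) [L.Structure M] : Set M :=
  {a | (∅ : Set M).Definable₁ L {a}}

/-- Parameters which are definable elements may be eliminated. -/
theorem definable_empty_of_definableElements {R : Set (α → M)}
    (hR : (definableElements L M).Definable L R) : (∅ : Set M).Definable L R := by
  obtain ⟨n, c, φ, hc, h⟩ := exists_formula_of_definable hR
  -- Each parameter becomes a quantified variable confined to its parameter-free definable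
  -- singleton.
  have : (∅ : Set M).Definable L
      {v | ∃ u : Fin n → M, (∀ i, u i ∈ ({c i} : Set M)) ∧ φ.Realize (Sum.elim u v)} := by
    refine definable_exists_tuple
      (P := fun v u => (∀ i, u i ∈ ({c i} : Set M)) ∧ φ.Realize (Sum.elim u v)) ?_
    refine definable_and (definable_forall_finite fun i => definable_mem (hc i) _) ?_
    convert! (definable_realize φ).preimage_comp Sum.swap using 1
    ext w
    simp only [Set.mem_ofPred_eq, Set.mem_preimage]
    rw [iff_iff_eq]
    congr 1
    ext i
    rcases i with i | i <;> rfl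
  convert! this using 1
  ext v
  rw [h]
  constructor
  · exact fun h => ⟨c, fun _ => rfl, h⟩
  · rintro ⟨u, hu, h⟩
    rwa [show u = c from funext hu] at h

end Definability

/-! ### Axioms of PA and induction, read in a model -/

section Arithmetic

variable {M : Type*} [arith.Structure M]

/-- The element `0` of an arithmetic structure. -/
def zeroElt (M : Type*) [arith.Structure M] : M :=
  Structure.funMap (L := arith) ArithFunc.zero ![]

/-- The element `1` of an arithmetic structure. -/
def oneElt (M : Type*) [arith.Structure M] : M :=
  Structure.funMap (L := arith) ArithFunc.one ![]

/-- The sum of two elements of an arithmetic structure. -/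
def addElt (a b : M) : M :=
  Structure.funMap (L := arith) ArithFunc.add ![a, b]

/-- The successor `a + 1`. -/
def succElt (a : M) : M := addElt a (oneElt M)

variable {α : Type*}

@[simp]
theorem realize_tZero (v : α → M) : (tZero : arith.Term α).realize v = zeroElt M :=
  congrArg (Structure.funMap (L := arith) ArithFunc.zero) (Subsingleton.elim _ _)

@[simp]
theorem realize_tOne (v : α → M) : (tOne : arith.Term α).realize v = oneElt M :=
  congrArg (Structure.funMap (L := arith) ArithFunc.one) (Subsingleton.elim _ _)

@[simp]
theorem realize_tAdd (s t : arith.Term α) (v : α → M) :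
    (tAdd s t).realize v = addElt (s.realize v) (t.realize v) :=
  Term.realize_functions_apply₂

@[simp]
theorem realize_fLt {n : ℕ} (s t : arith.Term (α ⊕ Fin n)) (v : α → M) (xs : Fin n → M) :
    (fLt s t).Realize v xs ↔ Lt (s.realize (Sum.elim v xs)) (t.realize (Sum.elim v xs)) :=
  BoundedFormula.realize_rel₂

theorem isDef_of_formula (φ : arith.Formula (M ⊕ Fin 1)) :
    IsDef M {x | φ.Realize (Sum.elim id fun _ => x)} := by
  refine Set.definable_iff_exists_formula_sum.2
    ⟨φ.relabel (Sum.map (fun a => ⟨a, trivial⟩) id), ?_⟩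
  ext v
  simp only [Set.mem_ofPred_eq, Formula.realize_relabel]
  rw [iff_iff_eq]
  congr 1
  ext i
  rcases i with i | i
  · rfl
  · exact congrArg v (Subsingleton.elim _ _)

theorem basic_axiom (hPA : M ⊨ PA) {σ : arith.Sentence} (hσ : σ ∈ basicAxioms) : M ⊨ σ :=
  hPA.realize_of_mem σ (Or.inl hσ)

theorem succElt_ne_zeroElt (hPA : M ⊨ PA) (a : M) : succElt a ≠ zeroElt M := by
  have h : M ⊨ (∀' ∼(tAdd (&0) tOne =' tZero) : arith.Sentence) :=
    basic_axiom hPA (by simp [basicAxioms])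
  simpa [succElt, Sentence.Realize, Formula.Realize, Fin.snoc] using h a

theorem succElt_injective (hPA : M ⊨ PA) {a b : M} (hab : succElt a = succElt b) : a = b := by
  have h : M ⊨ (∀' ∀' ((tAdd (&0) tOne =' tAdd (&1) tOne) ⟹ (&0 =' &1)) : arith.Sentence) :=
    basic_axiom hPA (by simp [basicAxioms])
  have := h a b
  simp [Fin.snoc] at this
  exact this hab

theorem addElt_zeroElt (hPA : M ⊨ PA) (a : M) : addElt a (zeroElt M) = a := by
  have h : M ⊨ (∀' (tAdd (&0) tZero =' &0) : arith.Sentence) :=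
    basic_axiom hPA (by simp [basicAxioms])
  simpa [succElt, Sentence.Realize, Formula.Realize, Fin.snoc] using h a

theorem addElt_succElt (hPA : M ⊨ PA) (a b : M) :
    addElt a (succElt b) = succElt (addElt a b) := by
  have h : M ⊨ (∀' ∀' (tAdd (&0) (tAdd (&1) tOne) =' tAdd (tAdd (&0) (&1)) tOne) :
    arith.Sentence) := basic_axiom hPA (by simp [basicAxioms])
  simpa [succElt, Sentence.Realize, Formula.Realize, Fin.snoc] using h a b

theorem lt_iff_exists (hPA : M ⊨ PA) (a b : M) : Lt a b ↔ ∃ c, addElt a (succElt c) = b := by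
  have h : M ⊨ (∀' ∀' ((fLt (&0) (&1)) ⇔ ∃' (tAdd (&0) (tAdd (&2) tOne) =' &1)) :
    arith.Sentence) := basic_axiom hPA (by simp [basicAxioms])
  simpa [succElt, Sentence.Realize, Formula.Realize, Fin.snoc] using h a b

/-- Induction for sets definable with parameters. -/
theorem induction_of_isDef (hPA : M ⊨ PA) {P : M → Prop} (hP : IsDef M {x | P x})
    (zero : P (zeroElt M)) (succ : ∀ x, P x → P (succElt x)) (x : M) : P x := by
  obtain ⟨n, c, φ, -, hφ⟩ := exists_formula_of_definable hP
  have h : M ⊨ inductionAxiom φ := hPA.realize_of_mem _ (Or.inr ⟨n, φ, rfl⟩)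
  simp only [Sentence.Realize, inductionAxiom, Formula.realize_iAlls, Formula.realize_relabel]
    at h
  have h := h c
  simp only [Formula.Realize, BoundedFormula.realize_imp, BoundedFormula.realize_inf,
    BoundedFormula.realize_subst, BoundedFormula.realize_iAlls] at h
  have key (y : M) (f : Fin n ⊕ Fin 1 → M) (hf : f = Sum.elim c fun _ => y) :
      φ.Realize f ↔ P y := by
    rw [hf]
    exact (hφ fun _ => y).symm
  refine (key x _ ?_).1 (h ⟨(key (zeroElt M) _ ?_).2 zero, fun i hi =>
    (key (succElt (i 0)) _ ?_).2 (succ _ ((key (i 0) _ ?_).1 hi))⟩ fun _ => x)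
  all_goals
    ext j
    rcases j with j | j
    · rfl
    · simp [succElt, Subsingleton.elim j 0]

end Arithmetic

/-! ### Addition, the linear order and least elements -/

section Order

variable {M : Type*} [arith.Structure M]

local notation "𝟘" => zeroElt M

theorem zeroElt_addElt (hPA : M ⊨ PA) (a : M) : addElt 𝟘 a = a := by
  refine induction_of_isDef (P := fun a => addElt 𝟘 a = a) hPA ?_ (addElt_zeroElt hPA _)
    (fun x hx => by rw [addElt_succElt hPA, hx]) a
  convert! isDef_of_formula (M := M)
    ((tAdd tZero (Term.var (Sum.inr 0))).equal (Term.var (Sum.inr 0))) using 1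
  ext x
  simp

theorem succElt_addElt (hPA : M ⊨ PA) (a b : M) :
    addElt (succElt a) b = succElt (addElt a b) := by
  refine induction_of_isDef (P := fun b => addElt (succElt a) b = succElt (addElt a b)) hPA ?_
    (by simp only [addElt_zeroElt hPA]) (fun x hx => by simp only [addElt_succElt hPA, hx]) b
  convert! isDef_of_formula (M := M)
    ((tAdd (Term.var (Sum.inl (succElt a))) (Term.var (Sum.inr 0))).equal
      (tAdd (tAdd (Term.var (Sum.inl a)) (Term.var (Sum.inr 0))) tOne)) using 1
  ext x
  simp [succElt]

theorem addElt_comm (hPA : M ⊨ PA) (a b : M) : addElt a b = addElt b a := by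
  refine induction_of_isDef (P := fun b => addElt a b = addElt b a) hPA ?_
    (by rw [addElt_zeroElt hPA, zeroElt_addElt hPA])
    (fun x hx => by rw [addElt_succElt hPA, succElt_addElt hPA, hx]) b
  convert! isDef_of_formula (M := M)
    ((tAdd (Term.var (Sum.inl a)) (Term.var (Sum.inr 0))).equal
      (tAdd (Term.var (Sum.inr 0)) (Term.var (Sum.inl a)))) using 1
  ext x
  simp

theorem addElt_assoc (hPA : M ⊨ PA) (a b c : M) :
    addElt (addElt a b) c = addElt a (addElt b c) := by
  refine induction_of_isDef (P := fun c => addElt (addElt a b) c = addElt a (addElt b c)) hPA ?_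
    (by simp only [addElt_zeroElt hPA]) (fun x hx => by simp only [addElt_succElt hPA, hx]) c
  convert! isDef_of_formula (M := M)
    ((tAdd (Term.var (Sum.inl (addElt a b))) (Term.var (Sum.inr 0))).equal
      (tAdd (Term.var (Sum.inl a)) (tAdd (Term.var (Sum.inl b)) (Term.var (Sum.inr 0))))) using 1
  ext x
  simp

theorem addElt_right_cancel (hPA : M ⊨ PA) {a b c : M} (h : addElt a c = addElt b c) : a = b := by
  refine induction_of_isDef (P := fun c => addElt a c = addElt b c → a = b) hPA ?_
    (by simp only [addElt_zeroElt hPA, imp_self])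
    (fun x hx hx' => by
      simp only [addElt_succElt hPA] at hx'
      exact hx (succElt_injective hPA hx')) c h
  convert! isDef_of_formula (M := M)
    (((tAdd (Term.var (Sum.inl a)) (Term.var (Sum.inr 0))).equal
      (tAdd (Term.var (Sum.inl b)) (Term.var (Sum.inr 0)))).imp
      ((Term.var (Sum.inl a)).equal (Term.var (Sum.inl b)))) using 1
  ext x
  simp

theorem lt_irrefl' (hPA : M ⊨ PA) (a : M) : ¬ Lt a a := by
  rw [lt_iff_exists hPA]
  rintro ⟨c, hc⟩
  refine succElt_ne_zeroElt hPA c (addElt_right_cancel hPA (c := a) ?_)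
  rw [addElt_comm hPA, hc, zeroElt_addElt hPA]

theorem lt_trans' (hPA : M ⊨ PA) {a b c : M} (hab : Lt a b) (hbc : Lt b c) : Lt a c := by
  rw [lt_iff_exists hPA] at *
  obtain ⟨x, rfl⟩ := hab
  obtain ⟨y, rfl⟩ := hbc
  exact ⟨addElt (succElt x) y, by rw [addElt_assoc hPA, addElt_succElt hPA (succElt x)]⟩

theorem not_lt_zeroElt (hPA : M ⊨ PA) (a : M) : ¬ Lt a 𝟘 := by
  rw [lt_iff_exists hPA]
  rintro ⟨c, hc⟩
  rw [addElt_succElt hPA] at hc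
  exact succElt_ne_zeroElt hPA _ hc

theorem lt_succElt_self (hPA : M ⊨ PA) (a : M) : Lt a (succElt a) := by
  rw [lt_iff_exists hPA]
  exact ⟨𝟘, by rw [addElt_succElt hPA, addElt_zeroElt hPA]⟩

theorem definable_lt {A : Set M} {α : Type*} (i j : α) :
    A.Definable arith {v : α → M | Lt (v i) (v j)} := by
  convert! definable_realize (A := A)
    (Relations.formula₂ (L := arith) ArithRel.lt (Term.var i) (Term.var j)) using 1
  ext v
  exact Iff.symm Formula.realize_rel₂

theorem isDef_lt (b : M) : IsDef M {x | Lt x b} :=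
  definable_subst_one (P := fun v b => Lt (v 0) b) (definable_lt _ _) (Set.mem_univ b)

theorem isDef_gt (b : M) : IsDef M {x | Lt b x} :=
  definable_subst_one (P := fun v b => Lt b (v 0)) (definable_lt _ _) (Set.mem_univ b)

theorem eq_zeroElt_or_exists_succElt (hPA : M ⊨ PA) (a : M) : a = 𝟘 ∨ ∃ b, a = succElt b := by
  refine induction_of_isDef (P := fun a => a = 𝟘 ∨ ∃ b, a = succElt b) hPA ?_ (Or.inl rfl)
    (fun x _ => Or.inr ⟨x, rfl⟩) a
  -- By the axiom for `<`, being a successor is the same as being above `0`.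
  have h : IsDef M {x | ¬ x = 𝟘 → Lt 𝟘 x} :=
    definable_imp (definable_not (definable_eq_const 0 (Set.mem_univ _))) (isDef_gt 𝟘)
  convert! h using 1
  ext x
  simp [or_iff_not_imp_left, lt_iff_exists hPA, zeroElt_addElt hPA, eq_comm]

theorem lt_succElt_iff (hPA : M ⊨ PA) {a b : M} : Lt a (succElt b) ↔ Lt a b ∨ a = b := by
  constructor
  · intro h
    obtain ⟨c, hc⟩ := (lt_iff_exists hPA _ _).1 h
    rw [addElt_succElt hPA] at hc
    have hc := succElt_injective hPA hc
    rcases eq_zeroElt_or_exists_succElt hPA c with rfl | ⟨d, rfl⟩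
    · exact Or.inr (by rwa [addElt_zeroElt hPA] at hc)
    · exact Or.inl ((lt_iff_exists hPA _ _).2 ⟨d, hc⟩)
  · rintro (h | rfl)
    · exact lt_trans' hPA h (lt_succElt_self hPA b)
    · exact lt_succElt_self hPA a

theorem lt_trichotomy' (hPA : M ⊨ PA) (a b : M) : Lt a b ∨ a = b ∨ Lt b a := by
  refine induction_of_isDef (P := fun a => Lt a b ∨ a = b ∨ Lt b a) hPA ?_ ?_ ?_ a
  · have h : (Set.univ : Set M).Definable arith
        ({v : Fin 1 → M | Lt (v 0) b} ∪ ({v | v 0 = b} ∪ {v | Lt b (v 0)})) :=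
      (isDef_lt b).union ((definable_eq_const 0 (Set.mem_univ b)).union (isDef_gt b))
    exact h
  · rcases eq_zeroElt_or_exists_succElt hPA b with rfl | ⟨d, rfl⟩
    · exact Or.inr (Or.inl rfl)
    · exact Or.inl ((lt_iff_exists hPA _ _).2 ⟨d, zeroElt_addElt hPA _⟩)
  · rintro x (h | rfl | h)
    · obtain ⟨c, rfl⟩ := (lt_iff_exists hPA _ _).1 h
      rw [addElt_succElt hPA, ← succElt_addElt hPA]
      rcases eq_zeroElt_or_exists_succElt hPA c with rfl | ⟨d, rfl⟩
      · exact Or.inr (Or.inl (addElt_zeroElt hPA _).symm)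
      · exact Or.inl ((lt_iff_exists hPA _ _).2 ⟨d, rfl⟩)
    · exact Or.inr (Or.inr (lt_succElt_self hPA _))
    · exact Or.inr (Or.inr (lt_trans' hPA h (lt_succElt_self hPA _)))

/-- The least number principle for sets definable with parameters. -/
theorem exists_least_of_isDef (hPA : M ⊨ PA) {S : Set M} (hS : IsDef M S) (hne : S.Nonempty) :
    ∃ m ∈ S, ∀ y, Lt y m → y ∉ S := by
  by_contra! hcon
  obtain ⟨a, ha⟩ := hne
  -- Strong induction: the induction hypothesis concerns all elements below `x`.
  have key : ∀ x, ∀ y, Lt y x → y ∉ S := by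
    refine induction_of_isDef hPA ?_ (fun y hy => (not_lt_zeroElt hPA y hy).elim) ?_
    · refine definable_forall (P := fun v y => Lt y (v 0) → y ∉ S) ?_
      exact definable_imp (definable_lt _ _) (definable_not (definable_mem hS _))
    · intro x hx y hy hyS
      rcases (lt_succElt_iff hPA).1 hy with h | rfl
      · exact hx y h hyS
      · obtain ⟨z, hz, hzS⟩ := hcon y hyS
        exact hx z hz hzS
  exact key _ a (lt_succElt_self hPA a) ha

end Order

/-! ### Collection -/

section Bounding

variable {M : Type*} [arith.Structure M] {A : Set M} {α β : Type*}

theorem definable_lt_const (i : α) {b : M} (hb : b ∈ A) :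
    A.Definable arith {v : α → M | Lt (v i) b} :=
  definable_subst_one (P := fun v b => Lt (v i) b) (definable_lt _ _) hb

theorem definable_const_lt (i : α) {b : M} (hb : b ∈ A) :
    A.Definable arith {v : α → M | Lt b (v i)} :=
  definable_subst_one (P := fun v b => Lt b (v i)) (definable_lt _ _) hb

/-- If there is a witness for `ψ y`, there is one below `e`. -/
def HasWitnessBelow (ψ : (α → M) → M → Prop) (y : α → M) (e : M) : Prop :=
  (∃ x, ψ y x) → ∃ x, Lt x e ∧ ψ y x

theorem HasWitnessBelow.mono (hPA : M ⊨ PA) {ψ : (α → M) → M → Prop} {y : α → M} {e e' : M}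
    (h : HasWitnessBelow ψ y e) (he : ¬ Lt e' e) : HasWitnessBelow ψ y e' := by
  intro hy
  obtain ⟨x, hx, hxy⟩ := h hy
  refine ⟨x, ?_, hxy⟩
  rcases lt_trichotomy' hPA e e' with h | rfl | h
  · exact lt_trans' hPA hx h
  · exact hx
  · exact (he h).elim

theorem definable_hasWitnessBelow {ψ : (α → M) → M → Prop}
    (hψ : A.Definable arith {w : α ⊕ Fin 1 → M | ψ (fun i => w (Sum.inl i)) (w (Sum.inr 0))})
    (f : α → β) (j : β) :
    A.Definable arith {v : β → M | HasWitnessBelow ψ (fun i => v (f i)) (v j)} := by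
  refine definable_imp (definable_exists (P := fun v x => ψ (fun i => v (f i)) x) ?_)
    (definable_exists (P := fun v x => Lt x (v j) ∧ ψ (fun i => v (f i)) x) ?_)
  · exact definable_comp hψ (fun i => Sum.inl (f i)) (Sum.inr 0)
  · exact definable_and (definable_lt _ _)
      (definable_comp hψ (fun i => Sum.inl (f i)) (Sum.inr 0))

theorem exists_upper_bound (hPA : M ⊨ PA) (a b : M) : ∃ c, ¬ Lt c a ∧ ¬ Lt c b := by
  rcases lt_trichotomy' hPA a b with h | rfl | h
  · exact ⟨b, fun h' => lt_irrefl' hPA _ (lt_trans' hPA h h'), lt_irrefl' hPA b⟩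
  · exact ⟨a, lt_irrefl' hPA a, lt_irrefl' hPA a⟩
  · exact ⟨a, lt_irrefl' hPA a, fun h' => lt_irrefl' hPA _ (lt_trans' hPA h h')⟩

/-- The collection principle for tuples. -/
theorem exists_bound_of_witnesses [Finite α] (hPA : M ⊨ PA) {ψ : (α → M) → M → Prop}
    (hψ : (Set.univ : Set M).Definable arith
      {w : α ⊕ Fin 1 → M | ψ (fun i => w (Sum.inl i)) (w (Sum.inr 0))}) (b : M) :
    ∃ e, ∀ y : α → M, (∀ i, Lt (y i) b) → HasWitnessBelow ψ y e := by
  classical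
  have := Fintype.ofFinite α
  -- Only the coordinates in `s` vary below `b`; the others are frozen at `z`. External induction
  -- frees them one at a time.
  suffices key : ∀ (s : Finset α) (z : α → M), ∃ e, ∀ y : α → M,
      (∀ i, i ∈ s → Lt (y i) b) → (∀ i, i ∉ s → y i = z i) → HasWitnessBelow ψ y e by
    obtain ⟨e, he⟩ := key Finset.univ fun _ => b
    exact ⟨e, fun y hy => he y (fun i _ => hy i) fun i hi => (hi (Finset.mem_univ i)).elim⟩
  intro s
  induction s using Finset.induction_on with
  | empty =>
    intro z
    by_cases hz : ∃ x, ψ z x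
    · obtain ⟨x, hx⟩ := hz
      refine ⟨succElt x, fun y _ hy _ => ⟨x, lt_succElt_self hPA x, ?_⟩⟩
      rwa [show y = z from funext fun i => hy i (by simp)]
    · refine ⟨b, fun y _ hy h => (hz ?_).elim⟩
      rwa [show y = z from funext fun i => hy i (by simp)] at h
  | insert i s his ih =>
    intro z
    -- Induction inside `M` on the bound `t` for the new coordinate `i`; its step freezes that
    -- coordinate at `t` and applies `ih`.
    have main : ∀ t, ∃ e, ∀ y : α → M, (∀ j, j ∈ s → Lt (y j) b) →
        (∀ j, j ∉ insert i s → y j = z j) → Lt (y i) t → HasWitnessBelow ψ y e := by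
      refine induction_of_isDef hPA ?_ ?_ ?_
      · refine definable_exists (P := fun v e => ∀ y : α → M, (∀ j, j ∈ s → Lt (y j) b) →
          (∀ j, j ∉ insert i s → y j = z j) → Lt (y i) (v 0) → HasWitnessBelow ψ y e) ?_
        refine definable_forall_tuple (P := fun w y => (∀ j, j ∈ s → Lt (y j) b) →
          (∀ j, j ∉ insert i s → y j = z j) → Lt (y i) (w (Sum.inl 0)) →
          HasWitnessBelow ψ y (w (Sum.inr 0))) ?_
        refine definable_imp (definable_forall_finite fun j =>
          definable_imp (definable_prop _) (definable_lt_const _ (Set.mem_univ b))) ?_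
        refine definable_imp (definable_forall_finite fun j =>
          definable_imp (definable_prop _) (definable_eq_const _ (Set.mem_univ (z j)))) ?_
        exact definable_imp (definable_lt _ _) (definable_hasWitnessBelow hψ _ _)
      · exact ⟨b, fun y _ _ h => (not_lt_zeroElt hPA _ h).elim⟩
      · rintro t ⟨e₁, h₁⟩
        obtain ⟨e₂, h₂⟩ := ih (Function.update z i t)
        obtain ⟨e, he₁, he₂⟩ := exists_upper_bound hPA e₁ e₂
        refine ⟨e, fun y hys hyz hyt => ?_⟩
        rcases (lt_succElt_iff hPA).1 hyt with hyt | hyt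
        · exact (h₁ y hys hyz hyt).mono hPA he₁
        · refine (h₂ y hys fun j hj => ?_).mono hPA he₂
          rcases eq_or_ne j i with rfl | hji
          · simpa using hyt
          · simpa [hji] using hyz j (by simp [hji, hj])
    obtain ⟨e, he⟩ := main b
    exact ⟨e, fun y hys hyz => he y (fun j hj => hys j (Finset.mem_insert_of_mem hj)) hyz
      (hys i (Finset.mem_insert_self i s))⟩

end Bounding

/-! ### Definable elements of an expansion and the cut they generate -/

section DefinableElements

variable {M : Type*} [arith.Structure M] {L : FirstOrder.Language} [L.Structure M]

/-- Being least in `S` singles out `m`. Minimality is a hypothesis because `S` is definable only in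
`L`, where induction is not assumed. -/
theorem least_mem_definableElements (hPA : M ⊨ PA) (ι : arith →ᴸ L) [ι.IsExpansionOn M]
    {S : Set M} (hS : (definableElements L M).Definable₁ L S) {m : M} (hm : m ∈ S)
    (hmin : ∀ y, Lt y m → y ∉ S) : m ∈ definableElements L M := by
  refine definable_empty_of_definableElements ?_
  have h : (definableElements L M).Definable L
      {v : Fin 1 → M | v 0 ∈ S ∧ ∀ y, Lt y (v 0) → y ∉ S} := by
    refine definable_and hS (definable_forall (P := fun v y => Lt y (v 0) → y ∉ S) ?_)
    exact definable_imp ((definable_lt _ _).map_expansion ι) (definable_not (definable_mem hS _))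
  convert! h using 1
  ext v
  constructor
  · rintro (h : v 0 = m)
    exact ⟨h ▸ hm, h ▸ hmin⟩
  · rintro ⟨h₁, h₂⟩
    rcases lt_trichotomy' hPA (v 0) m with h | h | h
    · exact (hmin _ h h₁).elim
    · exact h
    · exact (h₂ _ h hm).elim

theorem exists_least_mem_definableElements (hPA : M ⊨ PA) (ι : arith →ᴸ L) [ι.IsExpansionOn M]
    {S : Set M} (hS : (definableElements L M).Definable₁ arith S) (hne : S.Nonempty) :
    ∃ m ∈ definableElements L M, m ∈ S := by
  obtain ⟨m, hm, hmin⟩ := exists_least_of_isDef hPA (hS.mono (Set.subset_univ _)) hne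
  exact ⟨m, least_mem_definableElements hPA ι (hS.map_expansion ι) hm hmin, hm⟩

theorem exists_gt_mem_definableElements (hPA : M ⊨ PA) (ι : arith →ᴸ L) [ι.IsExpansionOn M]
    {a : M} (ha : a ∈ definableElements L M) : ∃ b ∈ definableElements L M, Lt a b :=
  exists_least_mem_definableElements hPA ι (S := {x | Lt a x}) (definable_const_lt 0 ha)
    ⟨_, lt_succElt_self hPA a⟩

/-- The bounds given by collection form an arithmetically definable set over definable elements, so
the least one is definable. -/
theorem exists_bound_mem_definableElements {α : Type*} [Finite α] (hPA : M ⊨ PA) (ι : arith →ᴸ L)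
    [ι.IsExpansionOn M] {ψ : (α → M) → M → Prop}
    (hψ : (definableElements L M).Definable arith
      {w : α ⊕ Fin 1 → M | ψ (fun i => w (Sum.inl i)) (w (Sum.inr 0))})
    {b : M} (hb : b ∈ definableElements L M) :
    ∃ e ∈ definableElements L M, ∀ y : α → M, (∀ i, Lt (y i) b) → HasWitnessBelow ψ y e := by
  refine exists_least_mem_definableElements hPA ι
    (S := {e | ∀ y : α → M, (∀ i, Lt (y i) b) → HasWitnessBelow ψ y e}) ?_
    (exists_bound_of_witnesses hPA (hψ.mono (Set.subset_univ _)) b)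
  refine definable_forall_tuple
    (P := fun v y => (∀ i, Lt (y i) b) → HasWitnessBelow ψ y (v 0)) ?_
  exact definable_imp (definable_forall_finite fun i => definable_lt_const _ hb)
    (definable_hasWitnessBelow hψ _ _)

/-- The elements lying below some definable element. -/
def boundedElements (L : FirstOrder.Language) (M : Type*) [arith.Structure M] [L.Structure M] :
    Set M :=
  {a | ∃ b ∈ definableElements L M, Lt a b}

theorem exists_bound_of_boundedElements (hPA : M ⊨ PA) (ι : arith →ᴸ L) [ι.IsExpansionOn M]
    {n : ℕ} {c : Fin n → M} (hc : ∀ i, c i ∈ boundedElements L M) :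
    ∃ b ∈ definableElements L M, ∀ i, Lt (c i) b := by
  induction n with
  | zero =>
    obtain ⟨b, hb, -⟩ := exists_least_mem_definableElements hPA ι (L := L) (S := Set.univ)
      Set.definable_univ ⟨zeroElt M, trivial⟩
    exact ⟨b, hb, fun i => i.elim0⟩
  | succ n ih =>
    obtain ⟨b, hb, h⟩ := ih fun i : Fin n => hc i.succ
    obtain ⟨b', hb', h'⟩ := hc 0
    rcases lt_trichotomy' hPA b b' with hbb | rfl | hbb
    · exact ⟨b', hb', Fin.cases h' fun i => lt_trans' hPA (h i) hbb⟩
    · exact ⟨b, hb, Fin.cases h' h⟩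
    · exact ⟨b, hb, Fin.cases (lt_trans' hPA h' hbb) h⟩

/-- Tarski–Vaught test, with least elements as witnesses. -/
theorem meetsDefinable_definableElements (hPA : M ⊨ PA) (ι : arith →ᴸ L) [ι.IsExpansionOn M] :
    arith.MeetsDefinable (definableElements L M) := by
  intro D hne hD
  obtain ⟨m, hm, hmD⟩ := exists_least_mem_definableElements hPA ι hD hne
  exact ⟨m, hmD, hm⟩

theorem definable_formula_tuple {A : Set M} {n : ℕ} (φ : arith.Formula (Fin n ⊕ Fin 1)) :
    A.Definable arith {w : Fin n ⊕ Fin 1 → M |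
      φ.Realize (Sum.elim (fun i => w (Sum.inl i)) fun _ => w (Sum.inr 0))} := by
  convert! definable_realize (A := A) φ using 1
  ext w
  simp only [Set.mem_ofPred_eq]
  rw [iff_iff_eq]
  congr 1
  ext j
  rcases j with j | j
  · rfl
  · exact congrArg (fun k => w (Sum.inr k)) (Subsingleton.elim _ _)

/-- Tarski–Vaught test: the parameters lie below a definable `b`, and collection over all tuples
below `b` gives a definable bound on a witness. -/
theorem meetsDefinable_boundedElements (hPA : M ⊨ PA) (ι : arith →ᴸ L) [ι.IsExpansionOn M] :
    arith.MeetsDefinable (boundedElements L M) := by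
  rintro D ⟨a, ha⟩ hD
  obtain ⟨n, c, φ, hc, hφ⟩ := exists_formula_of_definable hD
  obtain ⟨b, hb, hcb⟩ := exists_bound_of_boundedElements hPA ι hc
  obtain ⟨e, he, h⟩ := exists_bound_mem_definableElements hPA ι
    (ψ := fun y x => φ.Realize (Sum.elim y fun _ => x)) (definable_formula_tuple φ) hb
  obtain ⟨x, hxe, hx⟩ := h c hcb ⟨a, (hφ fun _ => a).1 ha⟩
  exact ⟨x, (hφ fun _ => x).2 hx, e, he, hxe⟩

theorem mem_toElementarySubstructure {A : Set M} (hA : arith.MeetsDefinable A) {a : M} :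
    a ∈ hA.toElementarySubstructure ↔ a ∈ A := by
  change a ∈ (Substructure.closure arith A : Set M) ↔ a ∈ A
  rw [hA.closure_eq_self]

/-- The definable elements of an expansion of `M` by an undefinable class form an elementary
submodel, which can be neither a proper cofinal one nor a bounded one. -/
theorem definableElements_eq_univ (hPA : M ⊨ PA)
    (hcof : ∀ K : arith.ElementarySubstructure M, IsCofinal K → K = ⊤)
    (hcons : ∀ K : arith.ElementarySubstructure M, IsElementaryCut K → IsConservative K)
    (ι : arith →ᴸ L) [ι.IsExpansionOn M] {X : Set M} (hXL : (∅ : Set M).Definable₁ L X)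
    (hX : IsClass M X) (hXdef : ¬ IsDef M X) : definableElements L M = Set.univ := by
  by_contra hne
  let K := (meetsDefinable_definableElements (L := L) hPA ι).toElementarySubstructure
  have hK {a : M} : a ∈ K ↔ a ∈ definableElements L M :=
    mem_toElementarySubstructure _
  let C := (meetsDefinable_boundedElements (L := L) hPA ι).toElementarySubstructure
  have hC {a : M} : a ∈ C ↔ a ∈ boundedElements L M :=
    mem_toElementarySubstructure _
  have hnc : ¬ IsCofinal K := fun h => hne <| Set.eq_univ_of_forall fun a => by
    rw [← hK, hcof K h]
    trivial
  simp only [IsCofinal, not_forall, not_exists, not_and, not_or] at hnc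
  obtain ⟨a, ha⟩ := hnc
  have haC : a ∉ C := fun h => by
    obtain ⟨b, hb, hab⟩ := hC.1 h
    exact (ha b (hK.2 hb)).2 hab
  have hcut : ∀ x ∈ C, ∀ y, Lt y x → y ∈ C := by
    intro x hx y hyx
    obtain ⟨b, hb, hxb⟩ := hC.1 hx
    exact hC.2 ⟨b, hb, lt_trans' hPA hyx hxb⟩
  have hCa : ∀ x ∈ C, Lt x a := by
    intro x hx
    rcases lt_trichotomy' hPA x a with h | rfl | h
    · exact h
    · exact (haC hx).elim
    · exact (haC (hcut x hx a h)).elim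
  have hCne : C ≠ ⊤ := fun h => haC (h ▸ trivial)
  -- Since `C` lies below `a`, the trace on `C` of `X` cut off at `a` is all of `X ∩ C`.
  obtain ⟨n, c, φ, -, hφ⟩ := exists_formula_of_definable (hcons C ⟨hCne, hcut⟩ _ (hX a))
  let θ : (Fin n → M) → M → Prop := fun d x => φ.Realize (Sum.elim d fun _ => x)
  let c' : Fin n → M := fun i => c i
  have hθ : ∀ x ∈ C, (θ c' x ↔ x ∈ X) := by
    intro x hx
    have h₁ : x ∈ X ∧ Lt x a ↔ _ := hφ fun _ => ⟨x, hx⟩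
    -- Elementarity moves `φ` from `C` to `M`.
    rw [← C.subtype.map_formula] at h₁
    have h₂ : C.subtype ∘ Sum.elim c (fun _ : Fin 1 => ⟨x, hx⟩) = Sum.elim c' fun _ => x := by
      ext j
      rcases j with j | j <;> rfl
    rw [h₂] at h₁
    exact h₁.symm.trans (and_iff_left (hCa x hx))
  have hθdef (A : Set M) : A.Definable arith
      {w : Fin n ⊕ Fin 1 → M | θ (fun i => w (Sum.inl i)) (w (Sum.inr 0))} :=
    definable_formula_tuple φ
  have hθc : IsDef M {x | θ c' x} :=
    definable_subst_params
      (R := {w : Fin 1 ⊕ Fin n → M | θ (fun i => w (Sum.inr i)) (w (Sum.inl 0))})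
      (definable_comp (hθdef _) _ _) fun i => Set.mem_univ (c' i)
  obtain ⟨b, hb, hcb⟩ := exists_bound_of_boundedElements (L := L) hPA ι (c := c')
    fun i => hC.1 (c i).2
  -- Collection over pairs of tuples: if two tuples below `b` define different sets, the sets differ
  -- below `e`.
  obtain ⟨e, he, hsep⟩ := exists_bound_mem_definableElements (L := L) hPA ι
    (α := Fin n ⊕ Fin n)
    (ψ := fun y x => ¬ (θ (fun i => y (Sum.inl i)) x ↔ θ (fun i => y (Sum.inr i)) x))
    (definable_not (definable_iff (definable_comp (hθdef _) _ _) (definable_comp (hθdef _) _ _)))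
    hb
  have hbelow : ∀ z, Lt z e → (θ c' z ↔ z ∈ X) := fun z hz => hθ z (hC.2 ⟨e, he, hz⟩)
  -- The set defined by `c'`, described using only `b`, `e` and `X` in place of `c'`.
  let Y : Set M :=
    {x | ∃ d : Fin n → M, (∀ i, Lt (d i) b) ∧ (∀ z, Lt z e → (θ d z ↔ z ∈ X)) ∧ θ d x}
  have hY : ∀ x, x ∈ Y ↔ θ c' x := by
    intro x
    constructor
    · rintro ⟨d, hdb, hd, hdx⟩
      by_contra hcx
      obtain ⟨z, hze, hz⟩ := hsep (Sum.elim d c') (by rintro (i | i); exacts [hdb i, hcb i])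
        ⟨x, fun h => hcx (h.1 hdx)⟩
      exact hz ((hd z hze).trans (hbelow z hze).symm)
    · exact fun h => ⟨c', hcb, hbelow, h⟩
  have hXK : (definableElements L M).Definable₁ L X := hXL.mono (Set.empty_subset _)
  have hYdef : (definableElements L M).Definable₁ L Y := by
    refine definable_exists_tuple (P := fun v d => (∀ i, Lt (d i) b) ∧
      (∀ z, Lt z e → (θ d z ↔ z ∈ X)) ∧ θ d (v 0)) ?_
    refine definable_and (definable_forall_finite fun i =>
      (definable_lt_const _ hb).map_expansion ι) (definable_and ?_ ?_)
    · refine definable_forall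
        (P := fun w z => Lt z e → (θ (fun i => w (Sum.inr i)) z ↔ z ∈ X)) ?_
      exact definable_imp ((definable_lt_const _ he).map_expansion ι)
        (definable_iff ((definable_comp (hθdef _) _ _).map_expansion ι) (definable_mem hXK _))
    · exact (definable_comp (hθdef _) _ _).map_expansion ι
  obtain ⟨z, hz⟩ : ∃ z, ¬ (θ c' z ↔ z ∈ X) := by
    by_contra! h
    refine hXdef ?_
    rwa [show X = {x | θ c' x} from Set.ext fun x => (h x).symm]
  -- Cutting `X` off at `z + 1` makes the set of differences definable in `M`, since `X` is a class;
  -- the least number principle then applies.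
  obtain ⟨m, ⟨hmz, hm⟩, hmin⟩ := exists_least_of_isDef hPA
    (S := {x | Lt x (succElt z) ∧ ¬ (θ c' x ↔ (x ∈ X ∧ Lt x (succElt z)))})
    (definable_and (isDef_lt _) (definable_not (definable_iff hθc (hX _))))
    ⟨z, lt_succElt_self hPA z, fun h => hz (h.trans (and_iff_left (lt_succElt_self hPA z)))⟩
  rw [and_iff_left hmz] at hm
  have hmK : m ∈ definableElements L M := by
    refine least_mem_definableElements hPA ι (S := {x | ¬ (x ∈ Y ↔ x ∈ X)})
      (definable_not (definable_iff hYdef hXK)) (fun h => hm ((hY m).symm.trans h)) ?_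
    intro y hym hy
    have hyz := lt_trans' hPA hym hmz
    exact hmin y hym ⟨hyz, fun h => hy ((hY y).trans (h.trans (and_iff_left hyz)))⟩
  -- A definable element above `m` puts `m` in `C`, where `θ c'` and `X` agree.
  exact hm (hθ m (hC.2 (exists_gt_mem_definableElements hPA ι hmK)))

end DefinableElements

end PAModels

/-! ### Specialization to the expansion by a predicate for `X` -/

theorem mainTheorem1 (M : Type*) [PAModels.arith.Structure M]
    (hPA : M ⊨ PAModels.PA) (hcount : Countable M)
    (hcof : ∀ K : PAModels.arith.ElementarySubstructure M, PAModels.IsCofinal K → K = ⊤)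
    (hcons : ∀ K : PAModels.arith.ElementarySubstructure M,
      PAModels.IsElementaryCut K → PAModels.IsConservative K) :
    (∀ X : Set M, PAModels.IsClass M X → ¬ PAModels.IsDef M X →
      PAModels.PointwiseDefinable M X) ∧
    (¬ PAModels.IsPrimeModel M → PAModels.IsEnayat M) := by
  have key : ∀ X : Set M, PAModels.IsClass M X → ¬ PAModels.IsDef M X →
      PAModels.PointwiseDefinable M X := by
    intro X hX hXdef
    let := PAModels.predStructure X
    have hXL : (∅ : Set M).Definable₁ (PAModels.arith.sum PAModels.predLang) X := by
      have h : (∅ : Set M).Definable₁ PAModels.predLang X := by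
        refine Set.empty_definable_iff.2 ⟨Relations.formula₁ (L := PAModels.predLang)
          PAModels.PredRel.pred (Term.var 0), ?_⟩
        ext v
        exact Iff.symm Formula.realize_rel₁
      exact h.map_expansion LHom.sumInr
    intro a
    have h := PAModels.definableElements_eq_univ hPA hcof hcons LHom.sumInl hXL hX hXdef
    have ha : a ∈ PAModels.definableElements (PAModels.arith.sum PAModels.predLang) M :=
      h ▸ Set.mem_univ a
    exact ha
  exact ⟨key, fun hprime => ⟨hPA, hcount, hprime, key⟩⟩
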